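/- Let $\Gamma$ be a finite simple graph, and let $A_\Gamma=\langle g_v\ (v\in V(\Gamma)) \mid g_vg_w=g_wg_v \text{ whenever } v,w \text{ are adjacent}\rangle$ be the associated right-angled Artin group. Then there is an integer $n\ge 1$, depending only on $\Gamma$, such that every finite extension of $A_\Gamma$, i.e. every group $G$ having a finite-index subgroup isomorphic to $A_\Gamma$ (normal or not), embeds into the Brin–Thompson group $nV$. Here $nV$ is the group, under composition, of all homeomorphisms $h$ of the Cantor cube $X=(\{0,1\}^\omega)^n$ for which there are partitions $D_1,\dots,D_k$ and $R_1,\dots,R_k$ of $X$ into finitely many subcubes such that $h$ maps each $D_j$ onto $R_j$ by prefix replacement. A subcube is a set of the form $X(\alpha_1,\dots,\alpha_n)=\{(\alpha_1\cdot x_1,\dots,\alpha_n\cdot x_n) : x\in X\}$ with $\alpha_1,\dots,\alpha_n$ finite binary words, and prefix replacement from $X(\alpha_1,\dots,\alpha_n)$ to $X(\beta_1,\dots,\beta_n)$ is the map $(\alpha_1\cdot x_1,\dots,\alpha_n\cdot x_n)\mapsto(\beta_1\cdot x_1,\dots,\beta_n\cdot x_n)$. -/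

import Mathlib

/-! ### Right-angled Artin groups -/

/-- The defining relators of the right-angled Artin group of `Γ`: one commutator `[g_v, g_w]` for
each pair of adjacent vertices `v`, `w`. -/
def raagRels {V : Type*} (Γ : SimpleGraph V) : Set (FreeGroup V) :=
  {r | ∃ v w : V, Γ.Adj v w ∧
    r = FreeGroup.of v * FreeGroup.of w * (FreeGroup.of v)⁻¹ * (FreeGroup.of w)⁻¹}

/-- The right-angled Artin group `A_Γ = ⟨g_v (v ∈ V) | g_v g_w = g_w g_v for v, w adjacent⟩`. -/
abbrev RightAngledArtinGroup {V : Type*} (Γ : SimpleGraph V) : Type _ :=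
  PresentedGroup (raagRels Γ)

/-- `G` is a finite extension of `A`: `G` contains a copy of `A` as a subgroup of finite index.
The copy may or may not be normal; in particular this covers every group `G` in a short exact
sequence `1 → A → G → F → 1` with `F` finite. -/
def IsFiniteExtension (A G : Type*) [Group A] [Group G] : Prop :=
  ∃ i : A →* G, Function.Injective i ∧ i.range.FiniteIndex

/-- `G` embeds (as a group) into `H`. -/
def GroupEmbeds (G H : Type*) [Group G] [Group H] : Prop :=
  ∃ f : G →* H, Function.Injective f

/-! ### The Brin–Thompson groups -/

/-- The concatenation `a · x` of a finite binary string `a` and an infinite binary string `x`. -/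
def prependWord : List Bool → (ℕ → Bool) → ℕ → Bool
  | [], x => x
  | b :: a, x => fun k => Nat.casesOn k b (prependWord a x)

/-- The Cantor cube `({0,1}^ω)^n`; its topology is the product topology. -/
abbrev CantorCube (n : ℕ) : Type := Fin n → ℕ → Bool

/-- The map `(x_1, …, x_n) ↦ (α_1 · x_1, …, α_n · x_n)`. -/
def cubeMap {n : ℕ} (α : Fin n → List Bool) (x : CantorCube n) : CantorCube n :=
  fun i => prependWord (α i) (x i)

/-- The subcube `X(α_1, …, α_n)`: all points whose `i`-th coordinate begins with `α_i`. -/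
def subcube {n : ℕ} (α : Fin n → List Bool) : Set (CantorCube n) :=
  Set.range (cubeMap α)

/-- The subcubes with addresses `D j` partition the Cantor cube: each point lies in exactly one. -/
def IsCubePartition {n : ℕ} {ι : Type*} (D : ι → Fin n → List Bool) : Prop :=
  ∀ x : CantorCube n, ∃! j : ι, x ∈ subcube (D j)

/-- A homeomorphism of the Cantor cube is a rearrangement if there are partitions
`D_1, …, D_k` and `R_1, …, R_k` of the cube into finitely many subcubes such that it maps each
`D_j` to `R_j` by the canonical homeomorphism (prefix replacement). -/
def IsRearrangement {n : ℕ} (h : CantorCube n ≃ₜ CantorCube n) : Prop :=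
  ∃ (k : ℕ) (D R : Fin k → Fin n → List Bool),
    IsCubePartition D ∧ IsCubePartition R ∧
      ∀ (j : Fin k) (x : CantorCube n), h (cubeMap (D j) x) = cubeMap (R j) x

theorem prependWord_injective (a : List Bool) : Function.Injective (prependWord a) := by
  induction a with
  | nil => exact fun _ _ h => h
  | cons b a ih =>
    intro x y h
    apply ih
    funext k
    exact congrFun h (k + 1)

theorem prependWord_append (a b : List Bool) (x : ℕ → Bool) :
    prependWord (a ++ b) x = prependWord a (prependWord b x) := by
  induction a with
  | nil => rfl
  | cons c a ih => simp only [List.cons_append, prependWord, ih]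

theorem cubeMap_append {n : ℕ} (α β : Fin n → List Bool) (x : CantorCube n) :
    cubeMap (fun i => α i ++ β i) x = cubeMap α (cubeMap β x) := by
  funext i
  exact prependWord_append _ _ _

theorem prependWord_overlap (a b : List Bool) (x y : ℕ → Bool)
    (h : prependWord a x = prependWord b y) :
    a ++ b.drop a.length = b ++ a.drop b.length ∧
      ∃ z, x = prependWord (b.drop a.length) z ∧ y = prependWord (a.drop b.length) z := by
  induction a generalizing b with
  | nil => exact ⟨by simp, y, by simpa [prependWord] using h, by simp [prependWord]⟩
  | cons c a ih =>
    cases b with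
    | nil => exact ⟨by simp, x, by simp [prependWord], by simpa [prependWord] using h.symm⟩
    | cons d b =>
      have h0 : c = d := congrFun h 0
      have h1 : prependWord a x = prependWord b y := by
        funext k
        exact congrFun h (k + 1)
      obtain ⟨h2, z, hx, hy⟩ := ih b h1
      refine ⟨by simpa [h0] using h2, z, by simpa using hx, by simpa using hy⟩

theorem cubeMap_overlap {n : ℕ} (α β : Fin n → List Bool) (x y : CantorCube n)
    (h : cubeMap α x = cubeMap β y) :
    (∀ i, α i ++ (β i).drop (α i).length = β i ++ (α i).drop (β i).length) ∧
      ∃ z, x = cubeMap (fun i => (β i).drop (α i).length) z ∧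
        y = cubeMap (fun i => (α i).drop (β i).length) z := by
  have key := fun i => prependWord_overlap (α i) (β i) (x i) (y i) (congrFun h i)
  choose h1 z hx hy using key
  exact ⟨h1, z, funext hx, funext hy⟩

theorem mem_subcube_iff_of_map {n : ℕ} (h : CantorCube n ≃ₜ CantorCube n)
    (α β : Fin n → List Bool) (hab : ∀ x, h (cubeMap α x) = cubeMap β x) (y : CantorCube n) :
    h y ∈ subcube β ↔ y ∈ subcube α := by
  constructor
  · rintro ⟨x, hx⟩
    exact ⟨x, h.injective ((hab x).trans hx)⟩
  · rintro ⟨x, rfl⟩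
    exact ⟨x, (hab x).symm⟩

theorem isRearrangement_of_finite {n : ℕ} {ι : Type*} [Finite ι]
    (h : CantorCube n ≃ₜ CantorCube n) (D R : ι → Fin n → List Bool) (hD : IsCubePartition D)
    (hDR : ∀ j x, h (cubeMap (D j) x) = cubeMap (R j) x) : IsRearrangement h := by
  have hR : IsCubePartition R := by
    intro y
    obtain ⟨j, hj, hu⟩ := hD (h.symm y)
    refine ⟨j, ?_, fun j' hj' => hu j' ?_⟩
    · simpa using (mem_subcube_iff_of_map h _ _ (hDR j) (h.symm y)).2 hj
    · exact (mem_subcube_iff_of_map h _ _ (hDR j') (h.symm y)).1 (by simpa using hj')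
  let e := Finite.equivFin ι
  have tr : ∀ E : ι → Fin n → List Bool, IsCubePartition E →
      IsCubePartition (fun j => E (e.symm j)) := by
    intro E hE x
    obtain ⟨j, hj, hu⟩ := hE x
    refine ⟨e j, by simpa using hj, fun j' hj' => ?_⟩
    rw [← hu _ hj', Equiv.apply_symm_apply]
  exact ⟨Nat.card ι, _, _, tr D hD, tr R hR, fun j x => hDR _ x⟩

theorem isRearrangement_one {n : ℕ} : IsRearrangement (1 : CantorCube n ≃ₜ CantorCube n) :=
  isRearrangement_of_finite (ι := Unit) _ (fun _ _ => []) (fun _ _ => [])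
    (fun x => ⟨(), ⟨x, rfl⟩, fun _ _ => rfl⟩) (fun _ _ => rfl)

theorem IsRearrangement.inv {n : ℕ} {h : CantorCube n ≃ₜ CantorCube n} (hh : IsRearrangement h) :
    IsRearrangement h⁻¹ := by
  obtain ⟨k, D, R, hD, hR, hDR⟩ := hh
  refine ⟨k, R, D, hR, hD, fun j x => ?_⟩
  rw [← hDR]
  exact h.symm_apply_apply _

theorem IsRearrangement.mul {n : ℕ} {g f : CantorCube n ≃ₜ CantorCube n} (hg : IsRearrangement g)
    (hf : IsRearrangement f) : IsRearrangement (g * f) := by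
  obtain ⟨k, D, R, hD, -, hDR⟩ := hf
  obtain ⟨k', D', R', hD', -, hDR'⟩ := hg
  refine isRearrangement_of_finite
    (ι := {p : Fin k × Fin k' // ∃ x y, cubeMap (R p.1) x = cubeMap (D' p.2) y}) _
    (fun p i => D p.1.1 i ++ (D' p.1.2 i).drop (R p.1.1 i).length)
    (fun p i => R' p.1.2 i ++ (R p.1.1 i).drop (D' p.1.2 i).length) ?_ ?_
  · intro x
    obtain ⟨i, ⟨u, rfl⟩, hi⟩ := hD x
    obtain ⟨j, ⟨w, hw⟩, hj⟩ := hD' (f (cubeMap (D i) u))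
    have huw : cubeMap (R i) u = cubeMap (D' j) w := by rw [hw, hDR]
    obtain ⟨-, z, hz, -⟩ := cubeMap_overlap _ _ _ _ huw
    refine ⟨⟨(i, j), u, w, huw⟩, ⟨z, ?_⟩, ?_⟩
    · rw [cubeMap_append, ← hz]
    · rintro ⟨⟨i', j'⟩, u', w', h'⟩ ⟨z', hz'⟩
      obtain ⟨heq, -⟩ := cubeMap_overlap _ _ _ _ h'
      rw [cubeMap_append] at hz'
      have e1 : i' = i := hi i' ⟨_, hz'⟩
      have e2 : j' = j := by
        refine hj j' ⟨cubeMap (fun l => (R i' l).drop (D' j' l).length) z', ?_⟩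
        rw [← hz', hDR, ← cubeMap_append, ← cubeMap_append]
        exact congrArg (fun α => cubeMap α z') (funext fun l => (heq l).symm)
      subst e1 e2
      rfl
  · rintro ⟨⟨i, j⟩, u, w, h⟩ z
    obtain ⟨heq, -⟩ := cubeMap_overlap _ _ _ _ h
    change g (f _) = _
    rw [cubeMap_append, hDR, ← cubeMap_append, cubeMap_append (R' j), ← hDR', ← cubeMap_append]
    exact congrArg (fun α => g (cubeMap α z)) (funext heq)

/-- The Brin–Thompson group `nV`: the group, under composition, of all rearrangements of the
Cantor cube `({0,1}^ω)^n`. -/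
def BrinThompson (n : ℕ) : Subgroup (CantorCube n ≃ₜ CantorCube n) where
  carrier := {h | IsRearrangement h}
  one_mem' := isRearrangement_one
  mul_mem' := IsRearrangement.mul
  inv_mem' := IsRearrangement.inv

/-! The cube `X` is cut into `k` subcubes, one for each coset of a subgroup `H` of index `k`. If `H`
acts on `X` faithfully by rearrangements, the action of `G` induced from `H` permutes these
subcubes and acts inside them through `H`; it is again faithful and by rearrangements. So it is
enough to embed `A_Γ` itself.

For this use one coordinate for each pair of vertices. The generator `g_v` moves only the
coordinates of the pairs of non-adjacent vertices which contain `v`, so that adjacent vertices use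
disjoint sets of coordinates and their generators commute. On its own coordinates `g_v` has an
attracting and a repelling subcube, and the coordinate of a pair of non-adjacent vertices `v ≠ w` is
used to keep the subcubes of `v` away from those of `w`. A ping-pong argument shows that the action
of `A_Γ` is faithful. -/

/-! ### Partitions of the Cantor cube -/

section Word

theorem mem_range_prependWord_nil {x : ℕ → Bool} : x ∈ Set.range (prependWord []) :=
  ⟨x, rfl⟩

theorem mem_range_prependWord_cons {b : Bool} {a : List Bool} {x : ℕ → Bool} :
    x ∈ Set.range (prependWord (b :: a)) ↔
      x 0 = b ∧ (fun k => x (k + 1)) ∈ Set.range (prependWord a) := by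
  constructor
  · rintro ⟨y, rfl⟩
    exact ⟨rfl, y, rfl⟩
  · rintro ⟨rfl, y, hy⟩
    refine ⟨y, funext fun k => ?_⟩
    cases k with
    | zero => rfl
    | succ k => exact congrFun hy k

theorem continuous_prependWord (a : List Bool) : Continuous (prependWord a) := by
  induction a with
  | nil => exact continuous_id
  | cons b a ih =>
    refine continuous_pi fun k => ?_
    cases k with
    | zero => exact continuous_const
    | succ k => exact (continuous_apply k).comp ih

/-- A family of binary words is a complete prefix code if each infinite word begins with exactly
one of them. -/
def IsCompletePrefixCode {κ : Type*} (w : κ → List Bool) : Prop :=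
  ∀ x : ℕ → Bool, ∃! k, x ∈ Set.range (prependWord (w k))

namespace IsCompletePrefixCode

variable {κ κ' : Type*} {w : κ → List Bool}

theorem comp_equiv (hw : IsCompletePrefixCode w) (e : κ' ≃ κ) :
    IsCompletePrefixCode fun k => w (e k) :=
  fun x => (e.bijective.existsUnique_iff (p := fun k => x ∈ Set.range (prependWord (w k)))).1 (hw x)

theorem nil_of_unique [Unique κ] : IsCompletePrefixCode fun _ : κ => [] :=
  fun _ => ⟨default, mem_range_prependWord_nil, fun _ _ => Subsingleton.elim _ _⟩

theorem option (hw : IsCompletePrefixCode w) :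
    IsCompletePrefixCode fun o : Option κ => o.elim [false] fun k => true :: w k := by
  intro x
  cases hx : x 0 with
  | false =>
    refine ⟨none, mem_range_prependWord_cons.2 ⟨hx, mem_range_prependWord_nil⟩, ?_⟩
    rintro (_ | k) hk
    · rfl
    · exact absurd (hx.symm.trans (mem_range_prependWord_cons.1 hk).1) Bool.false_ne_true
  | true =>
    obtain ⟨k, hk, hu⟩ := hw fun m => x (m + 1)
    refine ⟨some k, mem_range_prependWord_cons.2 ⟨hx, hk⟩, ?_⟩
    rintro (_ | j) hj
    · exact absurd ((mem_range_prependWord_cons.1 hj).1.symm.trans hx) Bool.false_ne_true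
    · rw [hu j (mem_range_prependWord_cons.1 hj).2]

end IsCompletePrefixCode

theorem exists_isCompletePrefixCode (κ : Type*) [Finite κ] [Nonempty κ] :
    ∃ w : κ → List Bool, IsCompletePrefixCode w := by
  have hfin : ∀ m, ∃ w : Fin (m + 1) → List Bool, IsCompletePrefixCode w := by
    intro m
    induction m with
    | zero => exact ⟨_, .nil_of_unique (κ := Fin 1)⟩
    | succ m ih =>
      obtain ⟨w, hw⟩ := ih
      exact ⟨_, hw.option.comp_equiv (finSuccEquiv (m + 1))⟩
  obtain ⟨m, hm⟩ := Nat.exists_eq_succ_of_ne_zero (Nat.card_pos (α := κ)).ne'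
  obtain ⟨w, hw⟩ := hfin m
  exact ⟨_, hw.comp_equiv (Finite.equivFinOfCardEq hm)⟩

end Word

section Cube

variable {n : ℕ} {α : Fin n → List Bool}

theorem mem_subcube_iff {x : CantorCube n} :
    x ∈ subcube α ↔ ∀ c, x c ∈ Set.range (prependWord (α c)) := by
  constructor
  · rintro ⟨y, rfl⟩ c
    exact ⟨y c, rfl⟩
  · intro h
    choose y hy using h
    exact ⟨y, funext hy⟩

theorem cubeMap_injective (α : Fin n → List Bool) : Function.Injective (cubeMap α) :=
  fun _ _ h => funext fun c => prependWord_injective (α c) (congrFun h c)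

theorem continuous_cubeMap (α : Fin n → List Bool) : Continuous (cubeMap α) :=
  continuous_pi fun c => (continuous_prependWord (α c)).comp (continuous_apply c)

theorem cubeMap_append_mem_subcube (α β : Fin n → List Bool) (x : CantorCube n) :
    cubeMap (fun c => α c ++ β c) x ∈ subcube α :=
  ⟨_, (cubeMap_append α β x).symm⟩

theorem mem_subcube_update_nil {p : Fin n} {a : List Bool} {x : CantorCube n} :
    x ∈ subcube (Function.update (fun _ => []) p a) ↔ x p ∈ Set.range (prependWord a) := by
  rw [mem_subcube_iff]
  refine ⟨fun h => by simpa using h p, fun h c => ?_⟩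
  obtain rfl | hc := eq_or_ne c p
  · simpa using h
  · rw [Function.update_of_ne hc]
    exact mem_range_prependWord_nil

end Cube

theorem exists_isCubePartition {n : ℕ} (p : Fin n) (κ : Type*) [Finite κ] [Nonempty κ] :
    ∃ E : κ → Fin n → List Bool, IsCubePartition E ∧ ∀ k, ∀ c ≠ p, E k c = [] := by
  obtain ⟨w, hw⟩ := exists_isCompletePrefixCode κ
  exact ⟨fun k => Function.update (fun _ => []) p (w k),
    fun x => by simpa only [mem_subcube_update_nil] using hw (x p),
    fun k c hc => Function.update_of_ne hc _ _⟩

/-- The family of cubes obtained from `D` by cutting the cube `D i₀` into pieces as `E` cuts the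
whole Cantor cube. -/
def refineAt {n : ℕ} {ι κ : Type*} (D : ι → Fin n → List Bool) (i₀ : ι)
    (E : κ → Fin n → List Bool) : {i // i ≠ i₀} ⊕ κ → Fin n → List Bool :=
  Sum.elim (fun i => D i) fun k c => D i₀ c ++ E k c

theorem refineAt_eq_nil {n : ℕ} {ι κ : Type*} {D : ι → Fin n → List Bool}
    {E : κ → Fin n → List Bool} {c : Fin n} (hD : ∀ i, D i c = []) (hE : ∀ k, E k c = []) (i₀ : ι)
    (s : {i // i ≠ i₀} ⊕ κ) : refineAt D i₀ E s c = [] := by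
  cases s <;> simp [refineAt, hD, hE]

namespace IsCubePartition

variable {n : ℕ} {ι κ : Type*} {D R : ι → Fin n → List Bool}

theorem comp_equiv (hD : IsCubePartition D) (e : κ ≃ ι) : IsCubePartition fun k => D (e k) :=
  fun x => (e.bijective.existsUnique_iff (p := fun i => x ∈ subcube (D i))).1 (hD x)

theorem exists_cubeMap_eq (hD : IsCubePartition D) (x : CantorCube n) :
    ∃ i y, cubeMap (D i) y = x :=
  (hD x).exists

theorem eq_of_cubeMap_eq (hD : IsCubePartition D) {i j : ι} {x y : CantorCube n}
    (h : cubeMap (D i) x = cubeMap (D j) y) : i = j ∧ x = y := by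
  obtain rfl : i = j := (hD (cubeMap (D i) x)).unique ⟨x, rfl⟩ ⟨y, h.symm⟩
  exact ⟨rfl, cubeMap_injective _ h⟩

theorem of_exists_cubeMap_eq (hex : ∀ x, ∃ i y, cubeMap (D i) y = x)
    (huniq : ∀ i j x y, cubeMap (D i) x = cubeMap (D j) y → i = j) : IsCubePartition D := by
  intro x
  obtain ⟨i, y, rfl⟩ := hex x
  exact ⟨i, ⟨y, rfl⟩, fun j ⟨z, hz⟩ => huniq _ _ _ _ hz⟩

theorem sigma {κ : ι → Type*} (hD : IsCubePartition D) {E : ∀ i, κ i → Fin n → List Bool}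
    (hE : ∀ i, IsCubePartition (E i)) :
    IsCubePartition fun s : Σ i, κ i => fun c => D s.1 c ++ E s.1 s.2 c := by
  refine of_exists_cubeMap_eq (fun x => ?_) ?_
  · obtain ⟨i, y, rfl⟩ := hD.exists_cubeMap_eq x
    obtain ⟨k, z, rfl⟩ := (hE i).exists_cubeMap_eq y
    exact ⟨⟨i, k⟩, z, cubeMap_append _ _ _⟩
  · rintro ⟨i, k⟩ ⟨j, l⟩ x y h
    simp only [cubeMap_append] at h
    obtain ⟨rfl, h⟩ := hD.eq_of_cubeMap_eq h
    obtain ⟨rfl, -⟩ := (hE i).eq_of_cubeMap_eq h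
    rfl

theorem refineAt (hD : IsCubePartition D) (i₀ : ι) {E : κ → Fin n → List Bool}
    (hE : IsCubePartition E) : IsCubePartition (refineAt D i₀ E) := by
  refine of_exists_cubeMap_eq (fun x => ?_) ?_
  · obtain ⟨i, y, rfl⟩ := hD.exists_cubeMap_eq x
    obtain rfl | hi := eq_or_ne i i₀
    · obtain ⟨k, z, rfl⟩ := hE.exists_cubeMap_eq y
      exact ⟨.inr k, z, cubeMap_append _ _ _⟩
    · exact ⟨.inl ⟨i, hi⟩, y, rfl⟩
  · rintro (⟨i, hi⟩ | k) (⟨j, hj⟩ | l) x y h <;>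
      simp only [_root_.refineAt, Sum.elim_inl, Sum.elim_inr, cubeMap_append] at h <;>
      obtain ⟨hij, h⟩ := hD.eq_of_cubeMap_eq h
    · simp only [hij]
    · exact absurd hij hi
    · exact absurd hij.symm hj
    · rw [(hE.eq_of_cubeMap_eq h).1]

theorem brinThompson_ext (hD : IsCubePartition D) {g h : BrinThompson n}
    (hgh : ∀ i x, g.1 (cubeMap (D i) x) = h.1 (cubeMap (D i) x)) : g = h := by
  refine Subtype.ext (Homeomorph.ext fun x => ?_)
  obtain ⟨i, y, rfl⟩ := hD.exists_cubeMap_eq x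
  exact hgh i y

/-! ### Rearrangements defined on the cubes of a partition -/

section Piecewise

variable [Finite ι]

/-- The Cantor cube as the disjoint union of the cubes of a finite partition, each of them a copy
of the whole. -/
noncomputable def homeo (hD : IsCubePartition D) : (Σ _ : ι, CantorCube n) ≃ₜ CantorCube n :=
  Continuous.homeoOfEquivCompactToT2
    (f := Equiv.ofBijective (fun s : Σ _ : ι, CantorCube n => cubeMap (D s.1) s.2)
      ⟨fun ⟨i, x⟩ ⟨j, y⟩ h => by
        obtain ⟨rfl, rfl⟩ := hD.eq_of_cubeMap_eq h
        rfl,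
      fun x => by simpa using hD.exists_cubeMap_eq x⟩)
    (continuous_sigma fun i => continuous_cubeMap (D i))

theorem homeo_symm_cubeMap (hD : IsCubePartition D) (i : ι) (x : CantorCube n) :
    hD.homeo.symm (cubeMap (D i) x) = ⟨i, x⟩ :=
  hD.homeo.symm_apply_apply ⟨i, x⟩

/-- The homeomorphism which carries the `i`-th cube of one partition to the `i`-th cube of another
one, acting by `f i` after both are identified with the whole Cantor cube. -/
noncomputable def piecewiseHomeo (hD : IsCubePartition D) (hR : IsCubePartition R)
    (f : ι → CantorCube n ≃ₜ CantorCube n) : CantorCube n ≃ₜ CantorCube n :=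
  hD.homeo.symm.trans <| Homeomorph.trans
    { toEquiv := Equiv.sigmaCongrRight fun i => (f i).toEquiv
      continuous_toFun := continuous_sigma fun i => continuous_sigmaMk.comp (f i).continuous
      continuous_invFun := continuous_sigma fun i =>
        continuous_sigmaMk.comp (f i).symm.continuous }
    hR.homeo

theorem piecewiseHomeo_cubeMap (hD : IsCubePartition D) (hR : IsCubePartition R)
    (f : ι → CantorCube n ≃ₜ CantorCube n) (i : ι) (x : CantorCube n) :
    hD.piecewiseHomeo hR f (cubeMap (D i) x) = cubeMap (R i) (f i x) := by
  simp only [piecewiseHomeo, Homeomorph.trans_apply, homeo_symm_cubeMap]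
  rfl

theorem isRearrangement_piecewiseHomeo (hD : IsCubePartition D) (hR : IsCubePartition R)
    {f : ι → CantorCube n ≃ₜ CantorCube n} (hf : ∀ i, IsRearrangement (f i)) :
    IsRearrangement (hD.piecewiseHomeo hR f) := by
  choose k D' R' hD' _ hDR' using hf
  refine isRearrangement_of_finite (ι := Σ i, Fin (k i)) _ _
    (fun s c => R s.1 c ++ R' s.1 s.2 c) (hD.sigma hD') ?_
  rintro ⟨i, j⟩ x
  rw [cubeMap_append, piecewiseHomeo_cubeMap, hDR', cubeMap_append]

/-- `piecewiseHomeo` as an element of the Brin–Thompson group. -/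
noncomputable def piecewise (hD : IsCubePartition D) (hR : IsCubePartition R)
    (f : ι → BrinThompson n) : BrinThompson n :=
  ⟨hD.piecewiseHomeo hR fun i => (f i).1, hD.isRearrangement_piecewiseHomeo hR fun i => (f i).2⟩

theorem piecewise_cubeMap (hD : IsCubePartition D) (hR : IsCubePartition R)
    (f : ι → BrinThompson n) (i : ι) (x : CantorCube n) :
    (hD.piecewise hR f).1 (cubeMap (D i) x) = cubeMap (R i) ((f i).1 x) :=
  hD.piecewiseHomeo_cubeMap hR _ i x

/-- The action of the element `(f, σ)` of the permutational wreath product of the Brin–Thompson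
group with `Equiv.Perm ι`: it permutes the cubes of the partition by `σ` and acts by `f i` on the
`i`-th one before moving it. -/
noncomputable def wreath (hD : IsCubePartition D) (σ : Equiv.Perm ι) (f : ι → BrinThompson n) :
    BrinThompson n :=
  hD.piecewise (hD.comp_equiv σ) f

theorem wreath_cubeMap (hD : IsCubePartition D) (σ : Equiv.Perm ι) (f : ι → BrinThompson n)
    (i : ι) (x : CantorCube n) :
    (hD.wreath σ f).1 (cubeMap (D i) x) = cubeMap (D (σ i)) ((f i).1 x) :=
  hD.piecewise_cubeMap _ f i x

theorem wreath_mul_wreath (hD : IsCubePartition D) (σ τ : Equiv.Perm ι)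
    (f g : ι → BrinThompson n) :
    hD.wreath σ f * hD.wreath τ g = hD.wreath (σ * τ) fun i => f (τ i) * g i := by
  refine hD.brinThompson_ext fun i x => ?_
  change (hD.wreath σ f).1 ((hD.wreath τ g).1 _) = _
  simp only [wreath_cubeMap]
  rfl

theorem eq_of_wreath_eq (hD : IsCubePartition D) {σ τ : Equiv.Perm ι} {f g : ι → BrinThompson n}
    (h : hD.wreath σ f = hD.wreath τ g) : σ = τ ∧ f = g := by
  have key : ∀ i x, σ i = τ i ∧ (f i).1 x = (g i).1 x := fun i x =>
    hD.eq_of_cubeMap_eq (by rw [← hD.wreath_cubeMap, ← hD.wreath_cubeMap, h])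
  exact ⟨Equiv.ext fun i => (key i default).1,
    funext fun i => Subtype.ext (Homeomorph.ext fun x => (key i x).2)⟩

end Piecewise

end IsCubePartition

/-! ### Finite extensions -/

section CosetCocycle

variable {G : Type*} [Group G]

/-- The cocycle of the action of `G` on `G ⧸ H` with respect to the coset representatives
`Quotient.out`. It turns an action of `H` into the induced action of `G`. -/
noncomputable def cosetCocycle (H : Subgroup G) (g : G) (q : G ⧸ H) : H :=
  ⟨(g • q).out⁻¹ * g * q.out, by
    rw [mul_assoc, ← QuotientGroup.eq, QuotientGroup.out_eq', ← smul_eq_mul,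
      ← MulAction.Quotient.smul_coe, QuotientGroup.out_eq']⟩

theorem cosetCocycle_mul (H : Subgroup G) (g g' : G) (q : G ⧸ H) :
    cosetCocycle H (g * g') q = cosetCocycle H g (g' • q) * cosetCocycle H g' q :=
  Subtype.ext <| by simp [cosetCocycle, mul_smul, mul_assoc]

theorem eq_of_cosetCocycle_eq {H : Subgroup G} {g g' : G} {q : G ⧸ H} (hq : g • q = g' • q)
    (h : cosetCocycle H g q = cosetCocycle H g' q) : g = g' := by
  have h' : (g • q).out⁻¹ * g * q.out = (g' • q).out⁻¹ * g' * q.out := congrArg Subtype.val h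
  rwa [hq, mul_left_inj, mul_right_inj] at h'

end CosetCocycle

theorem groupEmbeds_brinThompson_of_finiteIndex {n : ℕ} [NeZero n] {G : Type*} [Group G]
    (H : Subgroup G) [H.FiniteIndex] (hH : GroupEmbeds H (BrinThompson n)) :
    GroupEmbeds G (BrinThompson n) := by
  obtain ⟨ψ, hψ⟩ := hH
  obtain ⟨D, hD, -⟩ := exists_isCubePartition (0 : Fin n) (G ⧸ H)
  refine ⟨MonoidHom.mk' (fun g => hD.wreath (MulAction.toPerm g) fun q => ψ (cosetCocycle H g q))
    fun g g' => ?_, fun g g' hgg' => ?_⟩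
  · rw [hD.wreath_mul_wreath]
    congr 1
    · exact Equiv.ext fun q => mul_smul g g' q
    · exact funext fun q => by rw [cosetCocycle_mul, map_mul, MulAction.toPerm_apply]
  · obtain ⟨hperm, hcocycle⟩ := hD.eq_of_wreath_eq hgg'
    let q : G ⧸ H := (1 : G)
    exact eq_of_cosetCocycle_eq (Equiv.congr_fun hperm q) (hψ (congrFun hcocycle q))

theorem IsFiniteExtension.groupEmbeds_brinThompson {n : ℕ} [NeZero n] {A G : Type*} [Group A]
    [Group G] (hG : IsFiniteExtension A G) (hA : GroupEmbeds A (BrinThompson n)) :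
    GroupEmbeds G (BrinThompson n) := by
  obtain ⟨i, hi, _⟩ := hG
  obtain ⟨φ, hφ⟩ := hA
  let e := (MonoidHom.ofInjective hi).symm
  exact groupEmbeds_brinThompson_of_finiteIndex i.range ⟨φ.comp e.toMonoidHom, hφ.comp e.injective⟩

/-! ### Ping-pong for right-angled Artin groups -/

namespace RightAngledArtinGroup

variable {V X : Type*} {Γ : SimpleGraph V}

theorem commute_of (v w : V) (h : Γ.Adj v w) :
    Commute (PresentedGroup.of v : RightAngledArtinGroup Γ) (PresentedGroup.of w) :=
  PresentedGroup.mk_eq_mk_of_mul_inv_mem ⟨v, w, h, by group⟩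

/-- The homomorphism given by commuting elements for adjacent vertices. -/
def lift {H : Type*} [Group H] (g : V → H) (hg : ∀ v w, Γ.Adj v w → Commute (g v) (g w)) :
    RightAngledArtinGroup Γ →* H :=
  PresentedGroup.toGroup (f := g) <| by
    rintro _ ⟨v, w, hvw, rfl⟩
    simp [(hg v w hvw).eq]

/-- The element represented by a word, with `(v, true)` for `g_v` and `(v, false)` for its inverse,
as in `FreeGroup.mk`. -/
def ofWord (Γ : SimpleGraph V) (l : List (V × Bool)) : RightAngledArtinGroup Γ :=
  PresentedGroup.mk (raagRels Γ) (FreeGroup.mk l)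

theorem lift_ofWord_singleton {H : Type*} [Group H] (g : V → H)
    (hg : ∀ v w, Γ.Adj v w → Commute (g v) (g w)) (v : V) (b : Bool) :
    lift g hg (ofWord Γ [(v, b)]) = if b then g v else (g v)⁻¹ := by
  change FreeGroup.lift g (FreeGroup.mk [(v, b)]) = _
  cases b <;> simp

theorem ofWord_surjective (Γ : SimpleGraph V) : Function.Surjective (ofWord Γ) :=
  (PresentedGroup.mk_surjective _).comp Quot.mk_surjective

theorem ofWord_nil : ofWord Γ [] = 1 :=
  map_one _

theorem ofWord_cons (p : V × Bool) (l : List (V × Bool)) :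
    ofWord Γ (p :: l) = ofWord Γ [p] * ofWord Γ l := by
  rw [ofWord, ofWord, ofWord, ← map_mul, FreeGroup.mul_mk, List.singleton_append]

theorem ofWord_cancel (v : V) (b : Bool) (l : List (V × Bool)) :
    ofWord Γ ((v, b) :: (v, !b) :: l) = ofWord Γ l :=
  congrArg (PresentedGroup.mk _) (Quot.sound FreeGroup.Red.Step.cons_not)

theorem ofWord_swap {p q : V × Bool} (h : Γ.Adj p.1 q.1) (l : List (V × Bool)) :
    ofWord Γ (p :: q :: l) = ofWord Γ (q :: p :: l) := by
  have hletter : ∀ v b, ofWord Γ [(v, b)] =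
      if b then PresentedGroup.of v else (PresentedGroup.of v)⁻¹ := by
    rintro v (_ | _) <;> rfl
  have hcomm : Commute (ofWord Γ [p]) (ofWord Γ [q]) := by
    rw [hletter, hletter]
    split_ifs <;> simpa using commute_of _ _ h
  rw [ofWord_cons p (q :: l), ofWord_cons q l, ofWord_cons q (p :: l), ofWord_cons p l,
    hcomm.left_comm]

/-- A word is geodesic if no shorter word represents the same element. -/
def IsGeodesic (Γ : SimpleGraph V) (l : List (V × Bool)) : Prop :=
  ∀ m, ofWord Γ m = ofWord Γ l → l.length ≤ m.length

theorem exists_isGeodesic (g : RightAngledArtinGroup Γ) : ∃ l, ofWord Γ l = g ∧ IsGeodesic Γ l := by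
  obtain ⟨l, rfl, hmin⟩ := exists_minimalFor_of_wellFoundedLT (fun l => ofWord Γ l = g)
    List.length (ofWord_surjective Γ g)
  exact ⟨l, rfl, fun m hm => (le_total _ _).elim id (hmin hm)⟩

namespace IsGeodesic

theorem tail {p : V × Bool} {l : List (V × Bool)} (h : IsGeodesic Γ (p :: l)) :
    IsGeodesic Γ l := by
  intro m hm
  simpa using h (p :: m) (by rw [ofWord_cons, hm, ← ofWord_cons])

theorem swap {p q : V × Bool} {l : List (V × Bool)} (h : IsGeodesic Γ (p :: q :: l))
    (hpq : Γ.Adj p.1 q.1) : IsGeodesic Γ (q :: p :: l) :=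
  fun m hm => h m (hm.trans (ofWord_swap hpq l).symm)

theorem ne_inv {v : V} {b : Bool} {q : V × Bool} {l : List (V × Bool)}
    (h : IsGeodesic Γ ((v, b) :: q :: l)) : q ≠ (v, !b) := by
  rintro rfl
  have := h l (ofWord_cancel v b l).symm
  simp only [List.length_cons] at this
  omega

end IsGeodesic

/-- Ping-pong for an action of a right-angled Artin group: each letter `p` (a generator or its
inverse) has an attracting set `S p`, and the attracting set of its inverse is its repelling set. -/
structure IsPingPong (φ : RightAngledArtinGroup Γ →* Equiv.Perm X) (S : V × Bool → Set X)
    (x : X) : Prop where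
  mapsTo_compl : ∀ v b, Set.MapsTo (φ (ofWord Γ [(v, b)])) (S (v, !b))ᶜ (S (v, b))
  mapsTo_of_adj : ∀ p q, Γ.Adj p.1 q.1 → Set.MapsTo (φ (ofWord Γ [p])) (S q) (S q)
  disjoint : ∀ p q, p ≠ q → ¬ Γ.Adj p.1 q.1 → Disjoint (S p) (S q)
  base_notMem : ∀ p, x ∉ S p

namespace IsPingPong

variable {φ : RightAngledArtinGroup Γ →* Equiv.Perm X} {S : V × Bool → Set X} {x : X}

theorem apply_ofWord_mem (h : IsPingPong φ S x) {l : List (V × Bool)} {p : V × Bool}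
    (hpl : IsGeodesic Γ (p :: l)) : φ (ofWord Γ (p :: l)) x ∈ S p := by
  obtain ⟨m, hm⟩ : ∃ m, l.length = m := ⟨_, rfl⟩
  induction m generalizing l p with
  | zero =>
    obtain rfl := List.length_eq_zero_iff.1 hm
    exact h.mapsTo_compl _ _ (h.base_notMem _)
  | succ m ih =>
    obtain ⟨q, l, rfl⟩ := List.exists_cons_of_length_eq_add_one hm
    replace hm : l.length = m := by simpa using hm
    by_cases hpq : Γ.Adj p.1 q.1
    · rw [ofWord_swap hpq, ofWord_cons, map_mul]
      exact h.mapsTo_of_adj q p hpq.symm (ih (hpl.swap hpq).tail hm)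
    · have hq : φ (ofWord Γ (q :: l)) x ∈ S q := ih hpl.tail hm
      rw [ofWord_cons, map_mul]
      refine h.mapsTo_compl _ _ (Set.disjoint_left.1 (h.disjoint q _ hpl.ne_inv ?_) hq)
      exact fun hadj => hpq hadj.symm

theorem injective (h : IsPingPong φ S x) : Function.Injective φ := by
  rw [injective_iff_map_eq_one]
  intro g hg
  obtain ⟨l, rfl, hl⟩ := exists_isGeodesic g
  cases l with
  | nil => exact ofWord_nil
  | cons p l =>
    have hmem := h.apply_ofWord_mem hl
    rw [hg] at hmem
    exact absurd hmem (h.base_notMem p)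

end IsPingPong

end RightAngledArtinGroup

/-! ### Maps acting on a set of coordinates -/

/-- `h` fixes the coordinates outside `O`, and its effect on those in `O` depends only on them. -/
structure ActsOnCoords {ι : Type*} {X : ι → Type*} (O : Set ι) (h : (∀ c, X c) → ∀ c, X c) :
    Prop where
  apply_of_notMem : ∀ x, ∀ c ∉ O, h x c = x c
  dependsOn : ∀ c ∈ O, DependsOn (fun x => h x c) O

namespace ActsOnCoords

variable {ι : Type*} {X : ι → Type*} {O P : Set ι} {g h : (∀ c, X c) → ∀ c, X c}

theorem apply_comp_of_mem (hg : ActsOnCoords O g) (hh : ActsOnCoords P h) (hOP : Disjoint O P)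
    (x : ∀ c, X c) {c : ι} (hc : c ∈ O) : g (h x) c = h (g x) c := by
  rw [hh.apply_of_notMem _ c (Set.disjoint_left.1 hOP hc)]
  exact hg.dependsOn c hc fun d hd => hh.apply_of_notMem x d (Set.disjoint_left.1 hOP hd)

theorem commute (hg : ActsOnCoords O g) (hh : ActsOnCoords P h) (hOP : Disjoint O P) :
    Function.Commute g h := by
  intro x
  funext c
  by_cases hO : c ∈ O
  · exact hg.apply_comp_of_mem hh hOP x hO
  by_cases hP : c ∈ P
  · exact (hh.apply_comp_of_mem hg hOP.symm x hP).symm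
  · simp only [hg.apply_of_notMem _ c hO, hh.apply_of_notMem _ c hP]

theorem mapsTo_of_dependsOn (hh : ActsOnCoords O h) (hOP : Disjoint O P) {S : Set (∀ c, X c)}
    (hS : DependsOn (· ∈ S) P) : Set.MapsTo h S S := by
  intro x hx
  have : (h x ∈ S) = (x ∈ S) :=
    hS fun c hc => hh.apply_of_notMem x c (Set.disjoint_right.1 hOP hc)
  rwa [this]

theorem symm {e : Equiv.Perm (∀ c, X c)} (he : ActsOnCoords O e) : ActsOnCoords O e.symm := by
  classical
  refine ⟨fun x c hc => ?_, fun c hc x y hxy => ?_⟩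
  · rw [← he.apply_of_notMem (e.symm x) c hc, e.apply_symm_apply]
  · -- `z` has the preimage of `x` on `O` and that of `y` elsewhere; then `e z = y`.
    let z := O.piecewise (e.symm x) (e.symm y)
    have hz : e z = y := by
      funext d
      by_cases hd : d ∈ O
      · rw [← hxy d hd, ← e.apply_symm_apply x]
        exact he.dependsOn d hd fun d' hd' => Set.piecewise_eq_of_mem _ _ _ hd'
      · have hzd : z d = e.symm y d := O.piecewise_eq_of_notMem _ _ hd
        rw [he.apply_of_notMem z d hd, hzd,
          ← he.apply_of_notMem (e.symm y) d hd, e.apply_symm_apply]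
    change e.symm x c = e.symm y c
    rw [← hz, e.symm_apply_apply]
    exact (Set.piecewise_eq_of_mem _ _ _ hc).symm

end ActsOnCoords

section Coords

variable {n : ℕ} {O : Set (Fin n)}

theorem dependsOn_mem_subcube {α : Fin n → List Bool} (hα : ∀ c ∉ O, α c = []) :
    DependsOn (· ∈ subcube α) O := by
  intro x y hxy
  simp only [mem_subcube_iff, eq_iff_iff]
  refine forall_congr' fun c => ?_
  by_cases hc : c ∈ O
  · rw [hxy c hc]
  · simp only [hα c hc, mem_range_prependWord_nil]

theorem IsCubePartition.actsOnCoords {ι : Type*} {D R : ι → Fin n → List Bool}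
    (hD : IsCubePartition D) (hDO : ∀ i, ∀ c ∉ O, D i c = []) (hRO : ∀ i, ∀ c ∉ O, R i c = [])
    {h : CantorCube n → CantorCube n} (hDR : ∀ i x, h (cubeMap (D i) x) = cubeMap (R i) x) :
    ActsOnCoords O h := by
  refine ⟨fun x c hc => ?_, fun c hc x y hxy => ?_⟩
  · obtain ⟨i, x, rfl⟩ := hD.exists_cubeMap_eq x
    rw [hDR]
    simp only [cubeMap, hDO i c hc, hRO i c hc]
  · obtain ⟨i, x, rfl⟩ := hD.exists_cubeMap_eq x
    obtain ⟨y, rfl⟩ : y ∈ subcube (D i) := (dependsOn_mem_subcube (hDO i) hxy).mp ⟨x, rfl⟩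
    simp only [hDR]
    exact congrArg (prependWord _) (prependWord_injective _ (hxy c hc))

theorem exists_brinThompson_mapsTo_compl {p : Fin n} (hp : p ∈ O) {ι : Type*} [Finite ι]
    {D : ι → Fin n → List Bool} (hD : IsCubePartition D) (hDO : ∀ i, ∀ c ∉ O, D i c = []) {i j : ι}
    (hij : i ≠ j) :
    ∃ h : BrinThompson n, ActsOnCoords O h.1 ∧
      Set.MapsTo h.1 (subcube (D j))ᶜ (subcube (D i)) := by
  have : Nonempty {k // k ≠ j} := ⟨⟨i, hij⟩⟩
  have : Nonempty {k // k ≠ i} := ⟨⟨j, hij.symm⟩⟩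
  obtain ⟨E, hE, hEp⟩ := exists_isCubePartition p {k // k ≠ j}
  obtain ⟨F, hF, hFp⟩ := exists_isCubePartition p {k // k ≠ i}
  -- `h` shrinks the cubes other than `D j` into `D i` and expands the pieces of `D j` to the cubes
  -- other than `D i`.
  have hsource := hD.refineAt j hF
  have htarget := (hD.refineAt i hE).comp_equiv (Equiv.sumComm _ _)
  let h := hsource.piecewise htarget 1
  have hh := hsource.piecewise_cubeMap htarget 1
  have hne : ∀ c ∉ O, c ≠ p := fun c hc => (ne_of_mem_of_not_mem hp hc).symm
  refine ⟨h, hsource.actsOnCoords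
    (fun s c hc => refineAt_eq_nil (hDO · c hc) (hFp · c (hne c hc)) j s)
    (fun s c hc => refineAt_eq_nil (hDO · c hc) (hEp · c (hne c hc)) i _) hh, fun x hx => ?_⟩
  obtain ⟨k, y, rfl⟩ := hD.exists_cubeMap_eq x
  have hk : k ≠ j := by
    rintro rfl
    exact hx ⟨y, rfl⟩
  exact (hh (.inl ⟨k, hk⟩) y).symm ▸ cubeMap_append_mem_subcube (D i) (E ⟨k, hk⟩) y

/-- Cut each coordinate in `O` according to its first two digits, which are given by `σ`. -/
noncomputable def twoDigitCube (O : Set (Fin n)) (σ : O → Bool × Bool) (c : Fin n) : List Bool :=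
  open Classical in if h : c ∈ O then [(σ ⟨c, h⟩).1, (σ ⟨c, h⟩).2] else []

theorem twoDigitCube_of_notMem (σ : O → Bool × Bool) (c : Fin n) (hc : c ∉ O) :
    twoDigitCube O σ c = [] :=
  dif_neg hc

theorem mem_subcube_twoDigitCube {σ : O → Bool × Bool} {x : CantorCube n} :
    x ∈ subcube (twoDigitCube O σ) ↔ ∀ c : O, (x c 0, x c 1) = σ c := by
  simp only [mem_subcube_iff, Subtype.forall]
  refine forall_congr' fun c => ?_
  by_cases hc : c ∈ O <;>
    simp only [twoDigitCube, hc, dite_true, dite_false, mem_range_prependWord_cons,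
      mem_range_prependWord_nil, Prod.ext_iff, and_true, forall_true_left, IsEmpty.forall_iff]

theorem isCubePartition_twoDigitCube (O : Set (Fin n)) : IsCubePartition (twoDigitCube O) :=
  fun x => ⟨fun c => (x c 0, x c 1), mem_subcube_twoDigitCube.2 fun _ => rfl,
    fun _ hσ => funext fun c => (mem_subcube_twoDigitCube.1 hσ c).symm⟩

end Coords

theorem mapsTo_symm_compl {X : Type*} {e : Equiv.Perm X} {S T : Set X} (h : Set.MapsTo e Sᶜ T) :
    Set.MapsTo e.symm Tᶜ S :=
  fun y hy => by_contra fun hS => hy (by simpa using h hS)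

/-! ### Embedding right-angled Artin groups -/

/-- The combinatorial data which place the generators of a right-angled Artin group in `nV`: the
set of coordinates moved by each generator, and the first digit of its attracting and repelling
subcubes in each of these coordinates. -/
structure CoordLabelling {V : Type*} (Γ : SimpleGraph V) (n : ℕ) where
  coords : V → Set (Fin n)
  label : V → Fin n → Bool
  exists_label : ∀ v, ∃ c ∈ coords v, label v c = true
  disjoint_of_adj : ∀ v w, Γ.Adj v w → Disjoint (coords v) (coords w)
  exists_label_ne : ∀ v w, v ≠ w → ¬ Γ.Adj v w →
    ∃ c, c ∈ coords v ∧ c ∈ coords w ∧ label v c ≠ label w c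

namespace CoordLabelling

variable {V : Type*} {Γ : SimpleGraph V} {n : ℕ} (L : CoordLabelling Γ n)

/-- The attracting subcube of the generator of `v` (for `(v, true)`) or of its inverse (for
`(v, false)`): in each coordinate of `v` the first digit is the label, the second one the sign. -/
noncomputable def region (p : V × Bool) : Set (CantorCube n) :=
  subcube (twoDigitCube (L.coords p.1) fun c => (L.label p.1 c, p.2))

variable {L}

theorem mem_region {p : V × Bool} {x : CantorCube n} :
    x ∈ L.region p ↔ ∀ c ∈ L.coords p.1, x c 0 = L.label p.1 c ∧ x c 1 = p.2 := by
  simp [region, mem_subcube_twoDigitCube]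

variable (L)

theorem dependsOn_mem_region (p : V × Bool) : DependsOn (· ∈ L.region p) (L.coords p.1) :=
  dependsOn_mem_subcube (twoDigitCube_of_notMem _)

theorem disjoint_region {p q : V × Bool} (hpq : p ≠ q) (hadj : ¬ Γ.Adj p.1 q.1) :
    Disjoint (L.region p) (L.region q) := by
  rw [Set.disjoint_left]
  intro x hxp hxq
  by_cases hv : p.1 = q.1
  · obtain ⟨c, hc, -⟩ := L.exists_label p.1
    have hsign : p.2 = q.2 :=
      (mem_region.1 hxp c hc).2.symm.trans (mem_region.1 hxq c (hv ▸ hc)).2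
    exact hpq (Prod.ext hv hsign)
  · obtain ⟨c, hcp, hcq, hne⟩ := L.exists_label_ne _ _ hv hadj
    exact hne ((mem_region.1 hxp c hcp).1.symm.trans (mem_region.1 hxq c hcq).1)

theorem const_false_notMem_region (p : V × Bool) : (fun _ _ => false) ∉ L.region p := by
  intro h
  obtain ⟨c, hc, hlabel⟩ := L.exists_label p.1
  simpa [hlabel] using (mem_region.1 h c hc).1

theorem exists_generator (v : V) :
    ∃ h : BrinThompson n, ActsOnCoords (L.coords v) h.1 ∧
      Set.MapsTo h.1 (L.region (v, false))ᶜ (L.region (v, true)) := by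
  obtain ⟨c, hc, -⟩ := L.exists_label v
  refine exists_brinThompson_mapsTo_compl hc (isCubePartition_twoDigitCube _)
    twoDigitCube_of_notMem fun h => ?_
  simpa using congrFun h ⟨c, hc⟩

theorem groupEmbeds (L : CoordLabelling Γ n) :
    GroupEmbeds (RightAngledArtinGroup Γ) (BrinThompson n) := by
  choose g hacts hmaps using L.exists_generator
  have hcomm : ∀ v w, Γ.Adj v w → Commute (g v) (g w) := fun v w hvw =>
    Subtype.ext <| Homeomorph.ext <| (hacts v).commute (hacts w) (L.disjoint_of_adj v w hvw)
  let φ := RightAngledArtinGroup.lift g hcomm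
  let toPerm : BrinThompson n →* Equiv.Perm (CantorCube n) :=
    MonoidHom.mk' (fun h => h.1.toEquiv) fun _ _ => rfl
  have hpingPong : RightAngledArtinGroup.IsPingPong (toPerm.comp φ) L.region fun _ _ => false :=
    { mapsTo_compl := by
        rintro v (_ | _) <;>
          rw [MonoidHom.comp_apply, RightAngledArtinGroup.lift_ofWord_singleton]
        exacts [mapsTo_symm_compl (e := toPerm (g v)) (hmaps v), hmaps v]
      mapsTo_of_adj := by
        rintro ⟨v, b⟩ q hvq
        have hletter : ActsOnCoords (L.coords v)
            (toPerm.comp φ (RightAngledArtinGroup.ofWord Γ [(v, b)])) := by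
          rw [MonoidHom.comp_apply, RightAngledArtinGroup.lift_ofWord_singleton]
          cases b
          exacts [(hacts v).symm (e := toPerm (g v)), hacts v]
        exact hletter.mapsTo_of_dependsOn (L.disjoint_of_adj _ _ hvq) (L.dependsOn_mem_region q)
      disjoint := fun _ _ => L.disjoint_region
      base_notMem := L.const_false_notMem_region }
  exact ⟨φ, Function.Injective.of_comp (f := toPerm) hpingPong.injective⟩

/-- The labelling with a coordinate for each pair of vertices: `v` uses the coordinates of the
pairs of non-adjacent vertices which contain it, and marks those in which it comes first. -/
noncomputable def ofPairs (Γ : SimpleGraph V) (e : V × V ↪ Fin n) : CoordLabelling Γ n where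
  coords v := e '' {a | ¬ Γ.Adj a.1 a.2 ∧ (v = a.1 ∨ v = a.2)}
  label v c := open Classical in decide (∃ w, e (v, w) = c)
  exists_label v := ⟨e (v, v), ⟨(v, v), by simp, rfl⟩, by simp⟩
  disjoint_of_adj v w hvw := by
    rw [Set.disjoint_image_iff e.injective, Set.disjoint_left]
    rintro ⟨a, b⟩ ⟨hab, rfl | rfl⟩ ⟨-, rfl | rfl⟩
    exacts [hvw.ne rfl, hab hvw, hab hvw.symm, hvw.ne rfl]
  exists_label_ne v w hne hvw :=
    ⟨e (v, w), ⟨(v, w), by simp [hvw], rfl⟩, ⟨(v, w), by simp [hvw], rfl⟩, by simp [hne.symm]⟩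

end CoordLabelling

theorem mainTheorem3 {V : Type*} [Finite V] (Γ : SimpleGraph V) :
    ∃ n : ℕ, 1 ≤ n ∧
      ∀ (G : Type*) [Group G],
        IsFiniteExtension (RightAngledArtinGroup Γ) G → GroupEmbeds G (BrinThompson n) := by
  let e : V × V ↪ Fin (Nat.card (V × V) + 1) :=
    (Finite.equivFin (V × V)).toEmbedding.trans Fin.castSuccEmb
  exact ⟨_, Nat.succ_pos _, fun G _ hG =>
    hG.groupEmbeds_brinThompson (CoordLabelling.ofPairs Γ e).groupEmbeds⟩
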